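/- **Setting.** There are $n\ge 1$ bidders. Bidder $i$ has a private signal $s_i\in S_i$, where $S_i$ is a (partially) ordered set with least element $0$; a private monotone valuation $v_i:\mathbf S=S_1\times\dots\times S_n\to\mathbb R_{\ge 0}$; and a private number $d_i\in\mathbb N$ such that $v_i$ is $d_i$-critical, i.e. $|\{j: v_i(\mathbf s_{-j},0_j)<v_i(\mathbf s)\}|\le d_i$ for every $\mathbf s\in\mathbf S$. The sets of bidders that can be served simultaneously are the independent sets $\mathcal I$ of a matroid $M$ on $[n]$. A mechanism asks every bidder $i$ for a report $(\hat s_i,\hat v_i,\hat d_i)$ with $\hat v_i:\mathbf S\to\mathbb R_{\ge0}$; it then serves a random set of bidders and charges payments $p_i$. Let $x_i$ be the probability that $i$ is served. The mechanism is *EPIC-IR* if for all signals, monotone valuations and numbers $(\mathbf s,\mathbf v,\mathbf d)$ with each $v_i$ being $d_i$-critical, and every bidder $i$, the expected utility $x_i\cdot v_i(\mathbf s)-p_i$ under truthful reports is nonnegative, and $i$ cannot increase it by any misreport $(s_i',v_i',d_i')$ of its own while the other bidders report truthfully. **Mechanism.** Given reports $(\mathbf s,\mathbf v,\mathbf d)$: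 1. For a bidder $i$ and $t\ge 0$, let $w_{i,t}(i)=t$ and $w_{i,t}(j)=v_j(\mathbf s_{-i},0_i)$ for $j\ne i$, and let $G_i(t)$ be the output of the greedy algorithm for $M$ with weights $w_{i,t}$ (scan the bidders by decreasing weight, ties in favor of lower indices, and add a bidder whenever the set stays independent). Bidder $i$ is a *candidate* if $i\in G_i(v_i(\mathbf s))$. Let $\mathcal C$ be the set of candidates. 2. Let $\bar d^i=\max_{j\ne i}d_j$ (with $\max\emptyset=0$), let $\bar d=\max_j d_j$, and let $\tilde i$ be the bidder with the largest $d_i$ (the lowest index in case of ties). Then $\bar d^i=\bar d$ for all $i\neq\tilde i$. 3. Choose a partition of $\mathcal C\setminus\{\tilde i\}$ into $\bar d+1$ (possibly empty) independent sets. If none exists, serve nobody and charge nothing. Otherwise flip a fair coin. On heads, if $\tilde i\in\mathcal C$, serve $\{\tilde i\}$ with probability $1/(\bar d^{\tilde i}+1)$, and otherwise serve nobody. On tails, serve one of the $\bar d+1$ sets of the partition, chosen uniformly at random. 4. Bidder $i$ pays $p_i=x_i\,v_i(\mathbf s)-\int_0^{v_i(\mathbf s)}x_i(t)\,dt$, where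 $x_i(t)=\frac1{2(\bar d^i+1)}$ if $i\in G_i(t)$ and $x_i(t)=0$ otherwise. **Theorem.** For every matroid $M$ on $[n]$, the mechanism serves only independent sets, charges nonnegative payments (both for arbitrary reports), and is EPIC-IR. Moreover, for all $(\mathbf s,\mathbf v,\mathbf d)$ with each $v_i$ monotone and $d_i$-critical, under truthful reports the partition in step 3 exists, bidder $i$ is served with probability exactly $x_i=x_i(v_i(\mathbf s))$, and the expected welfare is a $2(\max_i d_i+1)$-approximation to the optimum: $$\max_{I\in\mathcal I}\sum_{i\in I}v_i(\mathbf s)\;\le\;2\bigl(\max_i d_i+1\bigr)\cdot\sum_{i=1}^n x_i\,v_i(\mathbf s).$$ -/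

import Mathlib

open scoped NNReal

namespace InterdependentAuction

/-- A nonnegative valuation, depending on the signals of all bidders. Bidder `j`'s signal space is
`S j`; its least signal (the signal `0`) is `⊥`. -/
abbrev Valuation {n : ℕ} (S : Fin n → Type*) := (∀ j, S j) → ℝ≥0

/-- `v` is `k`-critical: at every signal profile, zeroing out the signal of `j` strictly lowers the
value for at most `k` bidders `j`. -/
def IsCritical {n : ℕ} {S : Fin n → Type*} [∀ j, PartialOrder (S j)] [∀ j, OrderBot (S j)]
    (k : ℕ) (v : Valuation S) : Prop :=
  ∀ s : ∀ j, S j, (Finset.univ.filter fun j => v (Function.update s j ⊥) < v s).card ≤ k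

/-- The true types of the bidders: every valuation is monotone, and `v i` is `d i`-critical. -/
def IsTypeProfile {n : ℕ} {S : Fin n → Type*} [∀ j, PartialOrder (S j)] [∀ j, OrderBot (S j)]
    (v : Fin n → Valuation S) (d : Fin n → ℕ) : Prop :=
  ∀ i, Monotone (v i) ∧ IsCritical (d i) (v i)

/-! ### Mechanisms -/

/-- A randomized direct mechanism. Each bidder `i` reports a signal `s i`, a valuation `v i` and a
number `d i`; the mechanism draws a random set of served bidders and charges payments. Every
combination of reports is allowed. -/
structure Mechanism {n : ℕ} (S : Fin n → Type*) where
  /-- the distribution of the set of served bidders -/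
  outcome : (∀ j, S j) → (Fin n → Valuation S) → (Fin n → ℕ) → PMF (Finset (Fin n))
  /-- the payment of each bidder -/
  payment : (∀ j, S j) → (Fin n → Valuation S) → (Fin n → ℕ) → Fin n → ℝ

/-- The probability that bidder `i` belongs to the random set with distribution `μ`. -/
noncomputable def servedProb {n : ℕ} (μ : PMF (Finset (Fin n))) (i : Fin n) : ℝ :=
  ∑ A with i ∈ A, (μ A).toReal

namespace Mechanism

variable {n : ℕ} {S : Fin n → Type*}

/-- The allocation rule: the probability that bidder `i` is served. -/
noncomputable def alloc (𝓜 : Mechanism S) (s : ∀ j, S j) (v : Fin n → Valuation S)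
    (d : Fin n → ℕ) (i : Fin n) : ℝ :=
  servedProb (𝓜.outcome s v d) i

/-- The expected utility of a bidder `i` whose actual value is `value`, under reports `s, v, d`. -/
noncomputable def utility (𝓜 : Mechanism S) (value : ℝ≥0) (s : ∀ j, S j)
    (v : Fin n → Valuation S) (d : Fin n → ℕ) (i : Fin n) : ℝ :=
  𝓜.alloc s v d i * value - 𝓜.payment s v d i

/-- Only sets that are independent in `M` are ever served, whatever the reports. -/
def IsFeasible (𝓜 : Mechanism S) (M : Matroid (Fin n)) : Prop :=
  ∀ s v d, ∀ A ∈ (𝓜.outcome s v d).support, M.Indep (A : Set (Fin n))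

/-- Payments are nonnegative, whatever the reports. -/
def NonnegPayments (𝓜 : Mechanism S) : Prop :=
  ∀ s v d i, 0 ≤ 𝓜.payment s v d i

variable [∀ j, PartialOrder (S j)] [∀ j, OrderBot (S j)]

/-- Ex-post incentive compatibility. The deviating bidder may misreport signal, valuation and
criticality in any way; the misreported valuation need not be critical for the misreported number. -/
def ExPostIC (𝓜 : Mechanism S) : Prop :=
  ∀ s v d, IsTypeProfile v d →
    ∀ (i : Fin n) (s' : S i) (v' : Valuation S) (d' : ℕ),
      𝓜.utility (v i s) (Function.update s i s') (Function.update v i v')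
          (Function.update d i d') i
        ≤ 𝓜.utility (v i s) s v d i

/-- Ex-post individual rationality. -/
def ExPostIR (𝓜 : Mechanism S) : Prop :=
  ∀ s v d, IsTypeProfile v d → ∀ i : Fin n, 0 ≤ 𝓜.utility (v i s) s v d i

/-- Ex-post incentive compatible and ex-post individually rational. -/
def IsEPICIR (𝓜 : Mechanism S) : Prop :=
  𝓜.ExPostIC ∧ 𝓜.ExPostIR

end Mechanism

/-- The expected welfare of the random set with distribution `μ`. -/
noncomputable def expectedWelfare {n : ℕ} {S : Fin n → Type*} (μ : PMF (Finset (Fin n)))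
    (s : ∀ j, S j) (v : Fin n → Valuation S) : ℝ :=
  ∑ A, (μ A).toReal * ∑ i ∈ A, (v i s : ℝ)

open Classical in
/-- The optimal welfare: the largest total value of an independent set. -/
noncomputable def optWelfare {n : ℕ} {S : Fin n → Type*} (M : Matroid (Fin n))
    (s : ∀ j, S j) (v : Fin n → Valuation S) : ℝ≥0 :=
  (Finset.univ.filter fun A : Finset (Fin n) => M.Indep (A : Set (Fin n))).sup
    fun A => ∑ i ∈ A, v i s

/-! ### The greedy algorithm and the candidates -/

/-- `i` is considered no later than `j`: larger weights first, ties in favor of lower indices. -/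
def Precedes {n : ℕ} (w : Fin n → ℝ) (i j : Fin n) : Prop :=
  w j < w i ∨ (w i = w j ∧ i ≤ j)

open Classical in
/-- The greedy algorithm with weights `w` on the independent sets of `M`. -/
noncomputable def greedy {n : ℕ} (M : Matroid (Fin n)) (w : Fin n → ℝ) : Finset (Fin n) :=
  ((List.finRange n).insertionSort (Precedes w)).foldl
    (fun I j => if M.Indep (insert j I : Set (Fin n)) then insert j I else I) ∅

section Mech

variable {n : ℕ} {S : Fin n → Type*} [∀ j, PartialOrder (S j)] [∀ j, OrderBot (S j)]

/-- The weights used to decide whether `i`, with value `t`, is a candidate: `t` for `i` itself, and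
the shadow values, with `i`'s signal zeroed out, for all other bidders. -/
noncomputable def candidateWeight (s : ∀ j, S j) (v : Fin n → Valuation S) (i : Fin n) (t : ℝ) :
    Fin n → ℝ :=
  fun j => if j = i then t else (v j (Function.update s i ⊥) : ℝ)

/-- The set of candidates. -/
noncomputable def candidates (M : Matroid (Fin n)) (s : ∀ j, S j) (v : Fin n → Valuation S) :
    Finset (Fin n) :=
  Finset.univ.filter fun i => i ∈ greedy M (candidateWeight s v i (v i s))

/-- The maximum number reported by the bidders other than `i` (`0` if there are none). -/
def maxOthers (d : Fin n → ℕ) (i : Fin n) : ℕ :=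
  (Finset.univ.erase i).sup d

/-- The maximum number reported by any bidder. -/
def maxAll (d : Fin n → ℕ) : ℕ :=
  Finset.univ.sup d

/-- Some bidder reports the maximum number. -/
theorem exists_max_report [NeZero n] (d : Fin n → ℕ) :
    (Finset.univ.filter fun i => ∀ j, d j ≤ d i).Nonempty := by
  obtain ⟨i, -, hi⟩ := Finset.exists_max_image Finset.univ d Finset.univ_nonempty
  exact ⟨i, by simpa using hi⟩

/-- The bidder who reports the maximum number (the one of lowest index, in case of ties). -/
def topBidder [NeZero n] (d : Fin n → ℕ) : Fin n :=
  (Finset.univ.filter fun i => ∀ j, d j ≤ d i).min' (exists_max_report d)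

/-- `P` partitions `C` into `k` pairwise disjoint independent sets. Some of them may be empty, so
this is a partition into at most `k` nonempty independent sets. -/
def IsIndepPartition (M : Matroid (Fin n)) (C : Finset (Fin n)) (k : ℕ)
    (P : Fin k → Finset (Fin n)) : Prop :=
  (∀ a, M.Indep (P a : Set (Fin n))) ∧ (∀ a b, a ≠ b → Disjoint (P a) (P b)) ∧
    Finset.univ.biUnion P = C

/-- The candidates other than the top bidder admit the partition that the mechanism uses. -/
def Partitionable [NeZero n] (M : Matroid (Fin n)) (s : ∀ j, S j) (v : Fin n → Valuation S)
    (d : Fin n → ℕ) : Prop :=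
  ∃ P : Fin (maxAll d + 1) → Finset (Fin n),
    IsIndepPartition M ((candidates M s v).erase (topBidder d)) (maxAll d + 1) P

open Classical in
/-- The random set served by the mechanism. Flip a fair coin.
* Heads: if the top bidder is a candidate, serve that bidder alone with probability
  `1 / (maxOthers d (topBidder d) + 1)`; otherwise nobody.
* Tails: remove the top bidder from the candidates, partition the others into `maxAll d + 1`
  independent sets, and serve one of these, drawn uniformly.

If the reports admit no such partition (which can happen only if some reported valuation is not
monotone or not critical for the number reported with it), nobody is served. -/
noncomputable def cpOutcome [NeZero n] (M : Matroid (Fin n)) (s : ∀ j, S j)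
    (v : Fin n → Valuation S) (d : Fin n → ℕ) : PMF (Finset (Fin n)) :=
  if h : Partitionable M s v d then
    (PMF.uniformOfFintype Bool).bind fun heads =>
      if heads then
        (PMF.uniformOfFintype (Fin (maxOthers d (topBidder d) + 1))).map fun a =>
          if a = 0 ∧ topBidder d ∈ candidates M s v then {topBidder d} else ∅
      else
        (PMF.uniformOfFintype (Fin (maxAll d + 1))).map h.choose
  else PMF.pure ∅

open Classical in
/-- The allocation probability of `i` as a function of `i`'s value `t`, given the reports of the
others: `1 / (2 (maxOthers d i + 1))` if `i` is a candidate with value `t`, and `0` otherwise. It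
depends neither on `s i` nor on `v i` nor on `d i`. -/
noncomputable def allocCurve (M : Matroid (Fin n)) (s : ∀ j, S j) (v : Fin n → Valuation S)
    (d : Fin n → ℕ) (i : Fin n) (t : ℝ) : ℝ :=
  if i ∈ greedy M (candidateWeight s v i t) then 1 / (2 * ((maxOthers d i : ℝ) + 1)) else 0

open Classical in
/-- The payment rule `x_i * v_i(s) - ∫_0^{v_i(s)} x_i(t) dt`. No payments are made if the mechanism
serves nobody for lack of a partition. -/
noncomputable def cpPayment [NeZero n] (M : Matroid (Fin n)) (s : ∀ j, S j)
    (v : Fin n → Valuation S) (d : Fin n → ℕ) (i : Fin n) : ℝ :=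
  if Partitionable M s v d then
    servedProb (cpOutcome M s v d) i * v i s - ∫ t in (0 : ℝ)..(v i s : ℝ), allocCurve M s v d i t
  else 0

/-- The Candidate Partitioning mechanism for heterogeneous and privately known criticality. -/
noncomputable def cpMechanism [NeZero n] (M : Matroid (Fin n)) : Mechanism S where
  outcome := cpOutcome M
  payment := cpPayment M

end Mech

end InterdependentAuction

namespace InterdependentAuction

/-! Everything rests on one description of greedy (`mem_greedy_iff`): `i` is selected iff it lies in
the ground set and is not spanned by the bidders scanned before it. Whatever shrinks the set scanned
before `i` therefore keeps `i` selected. Raising the weight of `i` does so, hence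
`monotone_allocCurve`; so does lowering the other weights, hence the greedy set for the true values
consists of candidates (`greedy_subset_candidates`), and the candidates carry at least the optimal
welfare.

For the partition, draw an arc from `j` to `i` when zeroing the signal of `i` lowers the value of
`j`. Criticality bounds out-degrees, so the arcs from earlier to later bidders can be properly
coloured with one colour more than the bound (`exists_coloring`). Inside a colour class, zeroing the
signal of `i` leaves the values of all earlier members unchanged, so they do not span the candidate
`i`, and the class is independent.

Incentives are Myerson's argument: by `servedProb_cpOutcome` the allocation is a monotone curve
evaluated at the reported value, and by `allocCurve_update` no report of `i` moves that curve. A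
misreport that destroys the partition yields utility 0, which truth-telling already guarantees. -/

/-! ### The scanning order -/

/-- The position of `i` in the scanning order with weights `w`. -/
def scanKey {n : ℕ} (w : Fin n → ℝ) (i : Fin n) : ℝ ×ₗ Fin n :=
  toLex (-w i, i)

theorem precedes_iff_scanKey_le {n : ℕ} (w : Fin n → ℝ) (i j : Fin n) :
    Precedes w i j ↔ scanKey w i ≤ scanKey w j := by
  simp [Precedes, scanKey, Prod.Lex.toLex_le_toLex]

theorem scanKey_injective {n : ℕ} (w : Fin n → ℝ) : Function.Injective (scanKey w) := by
  intro i j h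
  simpa [scanKey] using congrArg (fun x => (ofLex x).2) h

/-- The bidders scanned strictly before `i`. -/
def scannedBefore {n : ℕ} (w : Fin n → ℝ) (i : Fin n) : Set (Fin n) :=
  {j | j ≠ i ∧ Precedes w j i}

/-! ### Matroid facts -/

theorem closure_insert_eq_of_not_indep {α : Type*} {M : Matroid α} {I : Set α} {e : α}
    (hI : M.Indep I) (h : ¬ M.Indep (insert e I)) : M.closure (insert e I) = M.closure I := by
  by_cases he : e ∈ M.E
  · refine Matroid.closure_insert_eq_of_mem_closure ?_
    by_contra hc
    exact h (hI.insert_indep_iff.2 (Or.inl ⟨he, hc⟩))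
  · rw [← M.closure_inter_ground, Set.insert_inter_of_notMem he, M.closure_inter_ground]

/-- A set is independent if none of its elements is spanned by the elements with smaller keys. -/
theorem indep_of_notMem_closure_of_key {α β : Type*} [Finite α] [LinearOrder β] {M : Matroid α}
    {X : Set α} (key : α → β) (hE : X ⊆ M.E)
    (h : ∀ i ∈ X, i ∉ M.closure {j | j ∈ X ∧ j ≠ i ∧ key j ≤ key i}) : M.Indep X := by
  by_contra hX
  obtain ⟨C, hCX, hC⟩ := ((M.not_indep_iff hE).1 hX).exists_isCircuit_subset
  -- The last element of a circuit is spanned by the rest of it, all of which has smaller keys.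
  obtain ⟨i, hi, hmax⟩ := Set.exists_max_image C key C.toFinite hC.nonempty
  refine h i (hCX hi) (M.closure_subset_closure ?_
    (hC.mem_closure_sdiff_singleton_of_mem hi))
  rintro j ⟨hj, hji⟩
  exact ⟨hCX hj, hji, hmax j hj⟩

/-! ### The greedy algorithm -/

open Classical in
/-- The greedy algorithm, scanning the list `L` from the initial set `I`. -/
noncomputable def greedyFrom {n : ℕ} (M : Matroid (Fin n)) (I : Finset (Fin n))
    (L : List (Fin n)) : Finset (Fin n) :=
  L.foldl (fun I j => if M.Indep (insert j I : Set (Fin n)) then insert j I else I) I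

section Greedy

variable {n : ℕ} {M : Matroid (Fin n)}

open Classical in
theorem greedyFrom_cons (I : Finset (Fin n)) (j : Fin n) (L : List (Fin n)) :
    greedyFrom M I (j :: L) =
      greedyFrom M (if M.Indep (insert j I : Set (Fin n)) then insert j I else I) L :=
  rfl

theorem greedyFrom_append (I : Finset (Fin n)) (L L' : List (Fin n)) :
    greedyFrom M I (L ++ L') = greedyFrom M (greedyFrom M I L) L' :=
  List.foldl_append

theorem subset_greedyFrom (I : Finset (Fin n)) (L : List (Fin n)) : I ⊆ greedyFrom M I L := by
  induction L generalizing I with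
  | nil => exact subset_rfl
  | cons j L ih =>
    rw [greedyFrom_cons]
    refine subset_trans ?_ (ih _)
    split_ifs
    · exact Finset.subset_insert _ _
    · exact subset_rfl

theorem greedyFrom_subset (I : Finset (Fin n)) (L : List (Fin n)) :
    greedyFrom M I L ⊆ I ∪ L.toFinset := by
  induction L generalizing I with
  | nil => simp [greedyFrom]
  | cons j L ih =>
    rw [greedyFrom_cons]
    refine (ih _).trans ?_
    intro x
    split_ifs <;> simp only [Finset.mem_union, Finset.mem_insert, List.toFinset_cons] <;> tauto

theorem indep_greedyFrom {I : Finset (Fin n)} (hI : M.Indep (I : Set (Fin n)))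
    (L : List (Fin n)) : M.Indep (greedyFrom M I L : Set (Fin n)) := by
  induction L generalizing I with
  | nil => exact hI
  | cons j L ih =>
    rw [greedyFrom_cons]
    refine ih ?_
    split_ifs with h
    · simpa using h
    · exact hI

/-- A rejected element is already spanned by the current set, so rejecting it loses no span. -/
theorem closure_greedyFrom {I : Finset (Fin n)} (hI : M.Indep (I : Set (Fin n)))
    (L : List (Fin n)) :
    M.closure (greedyFrom M I L : Set (Fin n)) = M.closure (I ∪ {j | j ∈ L}) := by
  induction L generalizing I with
  | nil => simp [greedyFrom]
  | cons j L ih =>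
    have hset : (I ∪ {x | x ∈ j :: L} : Set (Fin n)) = insert j (I : Set (Fin n)) ∪ {x | x ∈ L} := by
      ext x
      simp only [List.mem_cons, Set.mem_union, Set.mem_ofPred_eq, Set.mem_insert_iff]
      tauto
    rw [greedyFrom_cons, hset]
    split_ifs with h
    · rw [ih (by simpa using h), Finset.coe_insert]
    · rw [ih hI]
      exact (Matroid.closure_union_congr_left (closure_insert_eq_of_not_indep hI h)).symm

instance (w : Fin n → ℝ) : Std.Total (Precedes w) :=
  ⟨fun i j => by simpa only [precedes_iff_scanKey_le] using le_total _ _⟩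

instance (w : Fin n → ℝ) : IsTrans (Fin n) (Precedes w) :=
  ⟨fun i j k => by simpa only [precedes_iff_scanKey_le] using le_trans⟩

theorem indep_greedy (M : Matroid (Fin n)) (w : Fin n → ℝ) :
    M.Indep (greedy M w : Set (Fin n)) :=
  indep_greedyFrom (by simp) _

/-- The set collected before `i` is scanned spans exactly what the previously scanned bidders
span. -/
theorem exists_greedy_prefix (M : Matroid (Fin n)) (w : Fin n → ℝ) (i : Fin n) :
    ∃ I : Finset (Fin n), I ⊆ greedy M w ∧ (I : Set (Fin n)) ⊆ scannedBefore w i ∧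
      M.Indep (I : Set (Fin n)) ∧ M.closure I = M.closure (scannedBefore w i) ∧
      (i ∈ greedy M w ↔ M.Indep (insert i I : Set (Fin n))) := by
  classical
  set L := (List.finRange n).insertionSort (Precedes w) with hL
  have hperm : L.Perm (List.finRange n) := List.perm_insertionSort _ _
  have hnodup : L.Nodup := hperm.nodup_iff.2 (List.nodup_finRange n)
  have hsorted : L.Pairwise (Precedes w) := List.pairwise_insertionSort _ _
  have hgreedy : greedy M w = greedyFrom M ∅ L := by
    simp only [greedy, greedyFrom, hL]
  obtain ⟨L₁, L₂, hsplit⟩ := List.append_of_mem (hperm.mem_iff.2 (List.mem_finRange i))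
  rw [hsplit] at hnodup hsorted
  have hmem : ∀ j, j ∈ L₁ ∨ j = i ∨ j ∈ L₂ := fun j => by
    have := hperm.mem_iff.2 (List.mem_finRange j)
    rw [hsplit] at this
    simpa using this
  simp only [List.pairwise_append, List.pairwise_cons] at hsorted
  obtain ⟨hd₁, hd₂, hd₃⟩ := List.nodup_append.1 hnodup
  have hi₁ : i ∉ L₁ := fun h => hd₃ i h i (by simp) rfl
  have hi₂ : i ∉ L₂ := (List.nodup_cons.1 hd₂).1
  have hbefore : {j | j ∈ L₁} = scannedBefore w i := by
    ext j
    constructor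
    · exact fun hj => ⟨fun h => hi₁ (h ▸ hj), hsorted.2.2 j hj i (by simp)⟩
    · rintro ⟨hji, hpre⟩
      rcases hmem j with h | h | h
      · exact h
      · exact absurd h hji
      · rw [precedes_iff_scanKey_le] at hpre
        have := (precedes_iff_scanKey_le w i j).1 (hsorted.2.1.1 j h)
        exact absurd (scanKey_injective w (le_antisymm hpre this)) hji
  have hindep : M.Indep (greedyFrom M ∅ L₁ : Set (Fin n)) := indep_greedyFrom (by simp) _
  have hsub : (greedyFrom M ∅ L₁ : Set (Fin n)) ⊆ scannedBefore w i := by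
    rw [← hbefore]
    intro j hj
    simpa using greedyFrom_subset ∅ L₁ hj
  refine ⟨greedyFrom M ∅ L₁, ?_, hsub, hindep, ?_, ?_⟩
  · rw [hgreedy, hsplit, greedyFrom_append]
    exact subset_greedyFrom _ _
  · rw [closure_greedyFrom (by simp), hbefore]
    simp
  · rw [hgreedy, hsplit, greedyFrom_append, greedyFrom_cons]
    constructor
    · intro h
      -- If `i` is rejected at its turn it never returns: the scan has no duplicates.
      by_contra hc
      rw [if_neg hc] at h
      rcases Finset.mem_union.1 (greedyFrom_subset _ _ h) with h | h
      · exact (hsub h).1 rfl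
      · exact hi₂ (by simpa using h)
    · intro h
      rw [if_pos h]
      exact subset_greedyFrom _ _ (Finset.mem_insert_self _ _)

theorem mem_greedy_iff {w : Fin n → ℝ} {i : Fin n} :
    i ∈ greedy M w ↔ i ∈ M.E ∧ i ∉ M.closure (scannedBefore w i) := by
  obtain ⟨I, -, hI, hind, hcl, hiff⟩ := exists_greedy_prefix M w i
  rw [hiff, ← hcl, hind.insert_indep_iff]
  have : i ∉ (I : Set (Fin n)) := fun h => (hI h).1 rfl
  simp only [this, or_false]
  rfl

/-- The greedy set has maximum weight among the independent sets. -/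
theorem sum_le_sum_greedy (M : Matroid (Fin n)) (w : Fin n → ℝ≥0) (A : Finset (Fin n))
    (hA : M.Indep (A : Set (Fin n))) :
    ∑ i ∈ A, w i ≤ ∑ i ∈ greedy M (fun i => (w i : ℝ)), w i := by
  set G := greedy M (fun i => (w i : ℝ)) with hG
  -- Exchange argument: replace some `a` in `A \ G` by an element of `G` that is scanned earlier,
  -- hence weighs at least as much.
  induction hk : (A \ G).card using Nat.strong_induction_on generalizing A with
  | _ k ih =>
    by_cases hAG : A ⊆ G
    · exact Finset.sum_le_sum_of_subset hAG
    obtain ⟨a, haA, haG⟩ := Finset.not_subset.1 hAG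
    have haE : a ∈ M.E := hA.subset_ground haA
    obtain ⟨I, hIG, hIb, -, hcl, -⟩ := exists_greedy_prefix M (fun i => (w i : ℝ)) a
    have ha : a ∈ M.closure (I : Set (Fin n)) := by
      rw [hcl]
      by_contra hc
      exact haG (mem_greedy_iff.2 ⟨haE, hc⟩)
    have hind : M.Indep (A.erase a : Set (Fin n)) :=
      hA.subset (by simp)
    have hnot : a ∉ M.closure (A.erase a : Set (Fin n)) := by
      rw [Finset.coe_erase]
      exact hA.notMem_closure_sdiff_of_mem haA
    -- The prefix `I` spans `a` while `A.erase a` does not, so some element of `I` escapes the span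
    -- of `A.erase a`.
    obtain ⟨g, hgI, hg⟩ : ∃ g ∈ I, g ∉ M.closure (A.erase a : Set (Fin n)) := by
      by_contra! hc
      exact hnot (M.closure_subset_closure_of_subset_closure (fun g hg => hc g hg) ha)
    have hgE : g ∈ M.E := (indep_greedy M _).subset_ground (hIG hgI)
    have hgA : g ∉ A.erase a := fun h => hg (M.mem_closure_of_mem h hind.subset_ground)
    have hind' : M.Indep (insert g (A.erase a) : Finset (Fin n)) := by
      rw [Finset.coe_insert]
      exact hind.insert_indep_iff.2 (Or.inl ⟨hgE, hg⟩)
    have hwt : w a ≤ w g := by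
      rcases (hIb hgI).2 with h | h
      · exact_mod_cast h.le
      · exact_mod_cast h.1.ge
    have hcard : (insert g (A.erase a) \ G).card < k := by
      rw [← hk]
      refine Finset.card_lt_card ⟨?_, ?_⟩
      · intro x
        simp only [Finset.mem_sdiff, Finset.mem_insert, Finset.mem_erase]
        rintro ⟨rfl | h, hx⟩
        · exact absurd (hIG hgI) hx
        · exact ⟨h.2, hx⟩
      · intro h
        have := h (Finset.mem_sdiff.2 ⟨haA, haG⟩)
        simp only [Finset.mem_sdiff, Finset.mem_insert, Finset.mem_erase] at this
        rcases this.1 with h | h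
        · exact haG (h ▸ hIG hgI)
        · exact h.1 rfl
    refine le_trans ?_ (ih _ hcard _ hind' rfl)
    rw [Finset.sum_insert hgA, ← Finset.add_sum_erase A w haA]
    gcongr

end Greedy

/-! ### Colouring the influence arcs -/

/-- If every vertex has at most `k` out-neighbours, the arcs that point to larger keys can be
properly coloured with `k + 1` colours. -/
theorem exists_coloring {α β : Type*} [Fintype α] [LinearOrder β] (key : α → β)
    (hkey : Function.Injective key) (N : α → Finset α) (k : ℕ) (hN : ∀ j, (N j).card ≤ k) :
    ∃ c : α → Fin (k + 1), ∀ j i, j ≠ i → key j ≤ key i → i ∈ N j → c j ≠ c i := by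
  classical
  suffices h : ∀ s : Finset α, ∃ c : α → Fin (k + 1), ∀ j ∈ s, ∀ i ∈ s,
      j ≠ i → key j ≤ key i → i ∈ N j → c j ≠ c i by
    obtain ⟨c, hc⟩ := h Finset.univ
    exact ⟨c, fun j i => hc j (Finset.mem_univ j) i (Finset.mem_univ i)⟩
  intro s
  -- Colours are given from the largest key down, so a new vertex `a` only has to avoid the at most
  -- `k` colours of its own out-neighbours; arcs into `a` from larger keys are exempt.
  induction s using Finset.induction_on_min_value key with
  | empty => exact ⟨fun _ => 0, by simp⟩
  | insert a s ha hmin ih =>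
    obtain ⟨c, hc⟩ := ih
    obtain ⟨x, -, hx⟩ : ∃ x ∈ (Finset.univ : Finset (Fin (k + 1))), x ∉ (N a).image c := by
      refine Finset.exists_mem_notMem_of_card_lt_card ?_
      have := Finset.card_image_le (s := N a) (f := c)
      have := hN a
      simp only [Finset.card_univ, Fintype.card_fin]
      omega
    refine ⟨Function.update c a x, fun j hj i hi hji hle hiN => ?_⟩
    rcases Finset.mem_insert.1 hj with rfl | hjs
    · rw [Function.update_self, Function.update_of_ne hji.symm]
      exact fun h => hx (h ▸ Finset.mem_image_of_mem c hiN)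
    · have hja : j ≠ a := fun h => ha (h ▸ hjs)
      rcases Finset.mem_insert.1 hi with rfl | his
      · exact absurd (hkey (le_antisymm hle (hmin j hjs))) hji
      · rw [Function.update_of_ne hja, Function.update_of_ne fun h : i = a => ha (h ▸ his)]
        exact hc j hjs i his hji hle hiN

theorem expectedWelfare_eq_sum_servedProb {n : ℕ} {S : Fin n → Type*}
    (μ : PMF (Finset (Fin n))) (s : ∀ j, S j) (v : Fin n → Valuation S) :
    expectedWelfare μ s v = ∑ i, servedProb μ i * v i s := by
  classical
  simp only [expectedWelfare, servedProb, Finset.sum_mul, Finset.mul_sum, Finset.sum_filter]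
  rw [Finset.sum_comm]
  refine Finset.sum_congr rfl fun A _ => ?_
  simp [ite_mul]

/-! ### Candidates and their partition into independent sets -/

section Candidates

variable {n : ℕ} {S : Fin n → Type*} [∀ j, PartialOrder (S j)] [∀ j, OrderBot (S j)]
  {M : Matroid (Fin n)} {s : ∀ j, S j} {v : Fin n → Valuation S} {d : Fin n → ℕ}

theorem mem_candidates {i : Fin n} :
    i ∈ candidates M s v ↔ i ∈ greedy M (candidateWeight s v i (v i s)) := by
  simp [candidates]

theorem update_bot_le (s : ∀ j, S j) (i : Fin n) : Function.update s i ⊥ ≤ s :=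
  update_le_self_iff.2 bot_le

/-- A candidate is not spanned by the previous bidders whose values it does not influence. -/
theorem notMem_closure_of_mem_candidates {i : Fin n} (hi : i ∈ candidates M s v)
    {X : Set (Fin n)} (hX : X ⊆ scannedBefore (fun j => (v j s : ℝ)) i)
    (hcrit : ∀ j ∈ X, v j (Function.update s i ⊥) = v j s) : i ∉ M.closure X := by
  refine fun h => (mem_greedy_iff.1 (mem_candidates.1 hi)).2 (M.closure_subset_closure ?_ h)
  intro j hj
  obtain ⟨hji, hpre⟩ := hX hj
  refine ⟨hji, ?_⟩
  simpa [Precedes, candidateWeight, hji, hcrit j hj] using hpre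

/-- By monotonicity, zeroing the signal of `i` can only lower the other weights, so no new bidder
moves ahead of `i`. -/
theorem greedy_subset_candidates (hv : ∀ i, Monotone (v i)) :
    greedy M (fun j => (v j s : ℝ)) ⊆ candidates M s v := by
  intro i hi
  obtain ⟨hE, hcl⟩ := mem_greedy_iff.1 hi
  refine mem_candidates.2 (mem_greedy_iff.2 ⟨hE, fun h => hcl (M.closure_subset_closure ?_ h)⟩)
  rintro j ⟨hji, hpre⟩
  refine ⟨hji, ?_⟩
  have hle : v j (Function.update s i ⊥) ≤ v j s := hv j (update_bot_le s i)
  simp only [Precedes, candidateWeight, if_true, if_neg hji, NNReal.coe_lt_coe,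
    NNReal.coe_inj] at hpre ⊢
  rcases hpre with h | ⟨h, hij⟩
  · exact Or.inl (h.trans_le hle)
  · rcases (h ▸ hle).lt_or_eq with h' | h'
    · exact Or.inl h'
    · exact Or.inr ⟨h'.symm, hij⟩

/-- Any set of candidates splits into `k + 1` independent sets if all valuations are monotone and
`k`-critical. -/
theorem exists_isIndepPartition {k : ℕ} (hv : ∀ i, Monotone (v i))
    (hk : ∀ i, IsCritical k (v i)) {C : Finset (Fin n)} (hC : C ⊆ candidates M s v) :
    ∃ P : Fin (k + 1) → Finset (Fin n), IsIndepPartition M C (k + 1) P := by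
  classical
  obtain ⟨c, hc⟩ := exists_coloring (scanKey fun j => (v j s : ℝ)) (scanKey_injective _)
    (fun j => Finset.univ.filter fun i => v j (Function.update s i ⊥) < v j s) k
    (fun j => hk j s)
  refine ⟨fun a => C.filter fun i => c i = a, fun a => ?_, fun a b hab => ?_, ?_⟩
  · refine indep_of_notMem_closure_of_key (scanKey fun j => (v j s : ℝ)) ?_ ?_
    · intro i hi
      have := hC (Finset.mem_filter.1 hi).1
      exact (mem_greedy_iff.1 (mem_candidates.1 this)).1
    · intro i hi
      obtain ⟨hiC, rfl⟩ := Finset.mem_filter.1 hi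
      refine notMem_closure_of_mem_candidates (hC hiC) ?_ ?_
      · rintro j ⟨-, hji, hle⟩
        exact ⟨hji, (precedes_iff_scanKey_le _ _ _).2 hle⟩
      · rintro j ⟨hj, hji, hle⟩
        refine le_antisymm (hv j (update_bot_le s i)) (not_lt.1 fun hlt => ?_)
        exact hc j i hji hle (by simpa using hlt) (Finset.mem_filter.1 hj).2
  · refine Finset.disjoint_left.2 fun i hi hi' => hab ?_
    rw [← (Finset.mem_filter.1 hi).2, (Finset.mem_filter.1 hi').2]
  · ext i
    simp

theorem le_maxAll (d : Fin n → ℕ) (i : Fin n) : d i ≤ maxAll d :=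
  Finset.le_sup (Finset.mem_univ i)

theorem partitionable_of_isTypeProfile [NeZero n] (h : IsTypeProfile v d) :
    Partitionable M s v d :=
  exists_isIndepPartition (fun i => (h i).1)
    (fun i s => ((h i).2 s).trans (le_maxAll d i))
    (Finset.erase_subset _ _)

/-! ### Allocation probabilities -/

theorem maxOthers_le_maxAll (d : Fin n → ℕ) (i : Fin n) : maxOthers d i ≤ maxAll d :=
  Finset.sup_mono (Finset.erase_subset _ _)

/-- The maximum is attained at the top bidder, who is among the others. This frees the tails
probability of `i` from `d i`. -/
theorem maxOthers_eq_maxAll [NeZero n] {i : Fin n} (hi : i ≠ topBidder d) :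
    maxOthers d i = maxAll d := by
  refine le_antisymm (maxOthers_le_maxAll d i) (Finset.sup_le fun j _ => ?_)
  have htop : ∀ j, d j ≤ d (topBidder d) :=
    (Finset.mem_filter.1 (Finset.min'_mem _ (exists_max_report d))).2
  exact (htop j).trans (Finset.le_sup (f := d) (Finset.mem_erase.2 ⟨hi.symm, Finset.mem_univ _⟩))

theorem maxOthers_update (d : Fin n → ℕ) (i : Fin n) (d' : ℕ) :
    maxOthers (Function.update d i d') i = maxOthers d i :=
  Finset.sup_congr rfl fun _ hj => Function.update_of_ne (Finset.ne_of_mem_erase hj) _ _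

theorem servedProb_pure (A : Finset (Fin n)) (i : Fin n) :
    servedProb (PMF.pure A) i = if i ∈ A then 1 else 0 := by
  classical
  rw [servedProb, Finset.sum_filter, Finset.sum_eq_single A]
  · simp
  · intro B _ hB
    simp [PMF.pure_apply, hB]
  · simp

theorem servedProb_uniform_bind {α : Type*} [Fintype α] [Nonempty α]
    (f : α → PMF (Finset (Fin n))) (i : Fin n) :
    servedProb ((PMF.uniformOfFintype α).bind f) i =
      (∑ a, servedProb (f a) i) / Fintype.card α := by
  simp only [servedProb, PMF.bind_apply, tsum_fintype, PMF.uniformOfFintype_apply]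
  rw [Finset.sum_comm, Finset.sum_div]
  refine Finset.sum_congr rfl fun A _ => ?_
  rw [ENNReal.toReal_sum fun a _ => ENNReal.mul_ne_top (by simp) (PMF.apply_ne_top _ _),
    Finset.sum_div]
  refine Finset.sum_congr rfl fun a _ => ?_
  rw [ENNReal.toReal_mul, ENNReal.toReal_inv, ENNReal.toReal_natCast]
  ring

theorem servedProb_uniform_map {α : Type*} [Fintype α] [Nonempty α]
    (g : α → Finset (Fin n)) (i : Fin n) :
    servedProb ((PMF.uniformOfFintype α).map g) i =
      ((Finset.univ.filter fun a => i ∈ g a).card : ℝ) / Fintype.card α := by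
  rw [← PMF.bind_pure_comp, servedProb_uniform_bind]
  simp [servedProb_pure]

theorem card_filter_mem_of_isIndepPartition {C : Finset (Fin n)} {k : ℕ}
    {P : Fin k → Finset (Fin n)} (hP : IsIndepPartition M C k P) (i : Fin n) :
    (Finset.univ.filter fun a => i ∈ P a).card = if i ∈ C then 1 else 0 := by
  obtain ⟨-, hdisj, hU⟩ := hP
  subst hU
  split_ifs with h
  · obtain ⟨a, -, ha⟩ := Finset.mem_biUnion.1 h
    refine Finset.card_eq_one.2 ⟨a, ?_⟩
    ext b
    simp only [Finset.mem_filter, Finset.mem_univ, true_and, Finset.mem_singleton]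
    refine ⟨fun hb => ?_, fun hb => hb ▸ ha⟩
    by_contra hba
    exact Finset.disjoint_left.1 (hdisj b a hba) hb ha
  · refine Finset.card_eq_zero.2 (Finset.filter_eq_empty_iff.2 fun a _ ha => h ?_)
    exact Finset.mem_biUnion.2 ⟨a, Finset.mem_univ a, ha⟩

/-- Heads can serve only the top bidder and tails only the others, each candidate among them lying
in exactly one part. Truthfulness is not needed, so the formula also covers deviations. -/
theorem servedProb_cpOutcome [NeZero n] (h : Partitionable M s v d) (i : Fin n) :
    servedProb (cpOutcome M s v d) i = allocCurve M s v d i (v i s) := by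
  classical
  rw [cpOutcome, dif_pos h, servedProb_uniform_bind]
  simp only [Fintype.sum_bool, if_true, Bool.false_eq_true, if_false, servedProb_uniform_map,
    card_filter_mem_of_isIndepPartition h.choose_spec, Fintype.card_bool, Fintype.card_fin,
    allocCurve, ← mem_candidates, Finset.mem_erase]
  by_cases hi : i = topBidder d
  · subst hi
    by_cases hc : topBidder d ∈ candidates M s v
    · have : (Finset.univ.filter fun a : Fin (maxOthers d (topBidder d) + 1) =>
          topBidder d ∈ if a = 0 ∧ topBidder d ∈ candidates M s v then
            ({topBidder d} : Finset (Fin n)) else ∅) = {0} := by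
        ext a
        by_cases ha : a = 0 <;> simp [ha, hc]
      rw [this]
      simp [hc]
      field_simp
    · simp [hc]
  · have : (Finset.univ.filter fun a : Fin (maxOthers d (topBidder d) + 1) =>
        i ∈ if a = 0 ∧ topBidder d ∈ candidates M s v then
          ({topBidder d} : Finset (Fin n)) else ∅) = ∅ := by
      ext a
      by_cases ha : a = 0 ∧ topBidder d ∈ candidates M s v <;> simp [ha, hi]
    rw [this, maxOthers_eq_maxAll hi]
    by_cases hc : i ∈ candidates M s v
    · simp [hc, hi]
      field_simp
    · simp [hc]

/-! ### Payments -/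

theorem allocCurve_nonneg (i : Fin n) (t : ℝ) : 0 ≤ allocCurve M s v d i t := by
  rw [allocCurve]
  split_ifs <;> positivity

theorem monotone_allocCurve (i : Fin n) : Monotone (allocCurve M s v d i) := by
  intro t u htu
  by_cases h : i ∈ greedy M (candidateWeight s v i t)
  · have hu : i ∈ greedy M (candidateWeight s v i u) := by
      obtain ⟨hE, hcl⟩ := mem_greedy_iff.1 h
      refine mem_greedy_iff.2 ⟨hE, fun hc => hcl (M.closure_subset_closure ?_ hc)⟩
      rintro j ⟨hji, hpre⟩
      refine ⟨hji, ?_⟩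
      simp only [Precedes, candidateWeight, if_true, if_neg hji] at hpre ⊢
      rcases hpre with h | ⟨h, hij⟩
      · exact Or.inl (htu.trans_lt h)
      · rcases (h ▸ htu).lt_or_eq with h' | h'
        · exact Or.inl h'
        · exact Or.inr ⟨h'.symm, hij⟩
    rw [allocCurve, allocCurve, if_pos h, if_pos hu]
  · rw [allocCurve, if_neg h]
    exact allocCurve_nonneg i u

/-- The curve uses the other valuations only with the signal of `i` zeroed, replaces the weight of
`i` by `t`, and takes the maximum of `d` over the others. -/
theorem allocCurve_update (i : Fin n) (s' : S i) (v' : Valuation S) (d' : ℕ) :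
    allocCurve M (Function.update s i s') (Function.update v i v') (Function.update d i d') i =
      allocCurve M s v d i := by
  have : candidateWeight (Function.update s i s') (Function.update v i v') i =
      candidateWeight s v i := by
    ext t j
    by_cases hj : j = i <;> simp [candidateWeight, hj]
  ext t
  simp only [allocCurve, this, maxOthers_update]

/-- A monotone function lies below its tangent rectangles. -/
theorem mul_sub_le_integral_of_monotone {f : ℝ → ℝ} (hf : Monotone f) (a b : ℝ) :
    f a * (b - a) ≤ ∫ t in a..b, f t := by
  rcases le_total a b with hab | hab
  · calc f a * (b - a) = ∫ _ in a..b, f a := by simp [mul_comm]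
      _ ≤ ∫ t in a..b, f t := intervalIntegral.integral_mono_on hab (by simp)
          hf.intervalIntegrable fun t ht => hf ht.1
  · have : ∫ t in b..a, f t ≤ ∫ _ in b..a, f a :=
      intervalIntegral.integral_mono_on hab hf.intervalIntegrable (by simp) fun t ht => hf ht.2
    rw [intervalIntegral.integral_symm]
    simp only [intervalIntegral.integral_const, smul_eq_mul] at this
    linarith

/-- Here `y` is the actual value and `v i s` the reported one; the first term vanishes when they
agree. -/
theorem utility_cpMechanism [NeZero n] (h : Partitionable M s v d) (y : ℝ≥0) (i : Fin n) :
    (cpMechanism M : Mechanism S).utility y s v d i =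
      allocCurve M s v d i (v i s) * (y - v i s) +
        ∫ t in (0 : ℝ)..(v i s : ℝ), allocCurve M s v d i t := by
  simp only [Mechanism.utility, Mechanism.alloc, cpMechanism, cpPayment, if_pos h,
    servedProb_cpOutcome h]
  ring

theorem utility_cpMechanism_of_not_partitionable [NeZero n] (h : ¬ Partitionable M s v d)
    (y : ℝ≥0) (i : Fin n) : (cpMechanism M : Mechanism S).utility y s v d i = 0 := by
  simp [Mechanism.utility, Mechanism.alloc, cpMechanism, cpPayment, if_neg h, cpOutcome,
    dif_neg h, servedProb_pure]

theorem nonnegPayments_cpMechanism [NeZero n] (M : Matroid (Fin n)) :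
    (cpMechanism M : Mechanism S).NonnegPayments := by
  intro s v d i
  simp only [cpMechanism, cpPayment]
  split_ifs with h
  · have := mul_sub_le_integral_of_monotone (monotone_allocCurve (M := M) (s := s) (v := v)
      (d := d) i) (v i s) 0
    rw [intervalIntegral.integral_symm] at this
    rw [servedProb_cpOutcome h]
    linarith
  · exact le_rfl

theorem exPostIR_cpMechanism [NeZero n] (M : Matroid (Fin n)) :
    (cpMechanism M : Mechanism S).ExPostIR := by
  intro s v d hvd i
  rw [utility_cpMechanism (partitionable_of_isTypeProfile hvd), sub_self, mul_zero, zero_add]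
  exact intervalIntegral.integral_nonneg (NNReal.coe_nonneg _) fun t _ => allocCurve_nonneg i t

theorem exPostIC_cpMechanism [NeZero n] (M : Matroid (Fin n)) :
    (cpMechanism M : Mechanism S).ExPostIC := by
  intro s v d hvd i s' v' d'
  by_cases h : Partitionable M (Function.update s i s') (Function.update v i v')
      (Function.update d i d')
  · rw [utility_cpMechanism h, utility_cpMechanism (partitionable_of_isTypeProfile hvd),
      allocCurve_update, sub_self, mul_zero, zero_add, Function.update_self]
    have hmono := monotone_allocCurve (M := M) (s := s) (v := v) (d := d) i
    rw [← intervalIntegral.integral_add_adjacent_intervals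
      (hmono.intervalIntegrable (a := 0) (b := v' (Function.update s i s')))
      (hmono.intervalIntegrable (b := v i s))]
    -- The rectangle based at the reported value is at most the signed area from there to the true
    -- value, whether the report is too high or too low.
    have := mul_sub_le_integral_of_monotone hmono (v' (Function.update s i s')) (v i s)
    linarith
  · rw [utility_cpMechanism_of_not_partitionable h]
    exact exPostIR_cpMechanism M s v d hvd i

/-! ### Feasibility and welfare -/

theorem isFeasible_cpMechanism [NeZero n] (M : Matroid (Fin n)) :
    (cpMechanism M : Mechanism S).IsFeasible M := by
  classical
  intro s v d A hA
  change A ∈ (cpOutcome M s v d).support at hA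
  rw [cpOutcome] at hA
  split_ifs at hA with h
  · obtain ⟨b, -, hb⟩ := (PMF.mem_support_bind_iff _ _ _).1 hA
    cases b
    · obtain ⟨a, -, rfl⟩ := (PMF.mem_support_map_iff _ _ _).1 hb
      exact h.choose_spec.1 a
    · obtain ⟨a, -, rfl⟩ := (PMF.mem_support_map_iff _ _ _).1 hb
      split_ifs with hc
      -- A candidate belongs to some greedy set, so it is independent as a singleton.
      · refine (indep_greedy M (candidateWeight s v (topBidder d) (v (topBidder d) s))).subset ?_
        rw [Finset.coe_subset, Finset.singleton_subset_iff]
        exact mem_candidates.1 hc.2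
      · simp
  · rw [PMF.mem_support_pure_iff] at hA
    simp [hA]

theorem optWelfare_le_sum_candidates (hv : ∀ i, Monotone (v i)) :
    optWelfare M s v ≤ ∑ i ∈ candidates M s v, v i s := by
  classical
  refine Finset.sup_le fun A hA => ?_
  exact (sum_le_sum_greedy M (fun i => v i s) A (Finset.mem_filter.1 hA).2).trans
    (Finset.sum_le_sum_of_subset (greedy_subset_candidates hv))

theorem optWelfare_le_expectedWelfare [NeZero n] (h : IsTypeProfile v d) :
    (optWelfare M s v : ℝ) ≤
      2 * ((maxAll d : ℝ) + 1) * expectedWelfare (cpOutcome M s v d) s v := by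
  have hopt : (optWelfare M s v : ℝ) ≤ ∑ i ∈ candidates M s v, (v i s : ℝ) := by
    exact_mod_cast optWelfare_le_sum_candidates fun i => (h i).1
  refine hopt.trans ?_
  rw [expectedWelfare_eq_sum_servedProb, Finset.mul_sum]
  simp only [servedProb_cpOutcome (partitionable_of_isTypeProfile h)]
  refine (Finset.sum_le_sum fun i hi => ?_).trans (Finset.sum_le_sum_of_subset_of_nonneg
    (Finset.subset_univ _) fun i _ _ => mul_nonneg (by positivity)
      (mul_nonneg (allocCurve_nonneg i _) (NNReal.coe_nonneg _)))
  rw [← mul_assoc]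
  refine le_mul_of_one_le_left (NNReal.coe_nonneg _) ?_
  -- Each candidate is served with probability at least `1 / (2 * (maxAll d + 1))`; for the top
  -- bidder it may be larger.
  rw [allocCurve, if_pos (mem_candidates.1 hi), mul_one_div, one_le_div (by positivity)]
  have := maxOthers_le_maxAll d i
  gcongr

end Candidates

end InterdependentAuction

open InterdependentAuction in
theorem mainTheorem3 {n : ℕ} [NeZero n] (S : Fin n → Type*)
    [∀ j, PartialOrder (S j)] [∀ j, OrderBot (S j)] (M : Matroid (Fin n)) :
    -- the mechanism serves only independent sets and charges nonnegative payments
    (cpMechanism M : Mechanism S).IsFeasible M ∧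
    (cpMechanism M : Mechanism S).NonnegPayments ∧
    -- it is EPIC-IR
    (cpMechanism M : Mechanism S).IsEPICIR ∧
    ∀ (s : ∀ j, S j) (v : Fin n → Valuation S) (d : Fin n → ℕ), IsTypeProfile v d →
      -- the partition it uses exists
      Partitionable M s v d ∧
      -- the allocation probabilities are those from which the payments are computed
      (∀ i, (cpMechanism M : Mechanism S).alloc s v d i = allocCurve M s v d i (v i s)) ∧
      -- `2 (max_i d_i + 1)`-approximation of the optimal welfare
      (optWelfare M s v : ℝ) ≤
        2 * ((maxAll d : ℝ) + 1) *
          expectedWelfare ((cpMechanism M : Mechanism S).outcome s v d) s v := by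
  refine ⟨isFeasible_cpMechanism M, nonnegPayments_cpMechanism M,
    ⟨exPostIC_cpMechanism M, exPostIR_cpMechanism M⟩, fun s v d h => ?_⟩
  have hP : Partitionable M s v d := partitionable_of_isTypeProfile h
  exact ⟨hP, servedProb_cpOutcome hP, optWelfare_le_expectedWelfare h⟩
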